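/- All vector spaces are over $\mathbb C$. For a vector space $V$, an element $\tilde v\in S^rV$ is regarded as a homogeneous polynomial map of degree $r$ from $V^*$ to $\mathbb C$: the product $v_1\cdots v_r$ corresponds to $f\mapsto f(v_1)\cdots f(v_r)$. Let $V,W$ be finite-dimensional, $u\in(V\otimes W)^*$, $m\ge 1$, $\tilde v_1,\dots,\tilde v_m\in S^rV$, $\tilde w_1,\dots,\tilde w_m\in S^rW$. Let $\Gamma_{V,W}(m,r,\tilde v_1,\dots,\tilde v_m,\tilde w_1,\dots,\tilde w_m,u)$ be the set of decorated finite directed graphs (multiple arrows allowed) with $2m$ vertices $\alpha_1,\dots,\alpha_m,\beta_1,\dots,\beta_m$, such that each $\alpha_i$ has indegree $0$ and outdegree $r$ and is decorated by $\tilde v_i$, each $\beta_i$ has indegree $r$ and outdegree $0$ and is decorated by $\tilde w_i$, and all $rm$ arrows are decorated by $u$. So each arrow $a$ runs from some $\alpha_{t(a)}$ to some $\beta_{h(a)}$. The value $|\gamma|\in\mathbb C$ of such a graph $\gamma$ is defined by two conditions: it is linear in each $\tilde v_i$ and in each $\tilde w_i$, and if $\tilde v_i=v_i^r$ and $\tilde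 w_i=w_i^r$ with $v_i\in V$, $w_i\in W$ for all $i$, then $$|\gamma|=\prod_{a}u\bigl(v_{t(a)}\otimes w_{h(a)}\bigr),$$ the product being over all arrows $a$ of $\gamma$. **Proposition.** There is a function $\nu:\mathbb N\times\mathbb N\to\mathbb N$ with the following property. Let $V,W$ be finite-dimensional complex vector spaces with $d=\dim V$, and let $A\subset S^rV$, $B\subset S^rW$ be linear subspaces such that the polynomial maps $V^*\to\mathbb C$ given by the elements of $A$ have no common zero other than $0$, and likewise the polynomial maps $W^*\to\mathbb C$ given by the elements of $B$. Then for every nonzero $u\in(V\otimes W)^*$ there are a positive integer $m\le\nu(r,d)$, elements $\tilde v_1,\dots,\tilde v_m\in A$ and $\tilde w_1,\dots,\tilde w_m\in B$, and a decorated directed graph $\gamma\in\Gamma_{V,W}(m,r,\tilde v_1,\dots,\tilde v_m,\tilde w_1,\dots,\tilde w_m,u)$ such that $|\gamma|\neq0$. -/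

import Mathlib

open scoped TensorProduct

universe u v

noncomputable section

namespace SymPow

variable {V : Type u} [AddCommGroup V] [Module ℂ V] {r : ℕ}

/-- The linear map on the symmetric power `S^r V` induced by a symmetric multilinear form. -/
def lift (f : MultilinearMap ℂ (fun _ : Fin r => V) ℂ)
    (hf : ∀ (e : Equiv.Perm (Fin r)) (x : Fin r → V), f (fun i => x (e i)) = f x) :
    Sym[ℂ]^r V →ₗ[ℂ] ℂ where
  toFun := AddCon.lift _ (PiTensorProduct.lift f).toAddMonoidHom (by
    refine AddCon.addConGen_le.2 ?_
    rintro _ _ ⟨e, x⟩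
    rw [AddCon.ker_rel]
    simp [hf])
  map_add' := map_add _
  map_smul' c x := by
    induction x using AddCon.induction_on with
    | H x => exact (PiTensorProduct.lift f).map_smul c x

@[simp] theorem lift_tprod (f : MultilinearMap ℂ (fun _ : Fin r => V) ℂ)
    (hf : ∀ (e : Equiv.Perm (Fin r)) (x : Fin r → V), f (fun i => x (e i)) = f x)
    (x : Fin r → V) : lift f hf (SymmetricPower.tprod ℂ x) = f x := by
  change PiTensorProduct.lift f (PiTensorProduct.tprod ℂ x) = f x
  simp

/-- The value at the point `f` of `V*` of the homogeneous polynomial map `V* → ℂ` of degree `r`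
given by an element of `S^r V`: it sends `v₁ ⋯ v_r` to `f(v₁) ⋯ f(v_r)`. -/
def polyEval (f : Module.Dual ℂ V) : Sym[ℂ]^r V →ₗ[ℂ] ℂ :=
  lift ((MultilinearMap.mkPiAlgebra ℂ (Fin r) ℂ).compLinearMap fun _ => f) (by
    intro e x
    simpa using Equiv.prod_comp e fun i => f (x i))

@[simp] theorem polyEval_tprod (f : Module.Dual ℂ V) (x : Fin r → V) :
    polyEval f (SymmetricPower.tprod ℂ x) = ∏ l, f (x l) := by
  simp [polyEval]

/-- The common zeros in `V*` of the polynomial maps given by the elements of `A ⊆ S^r V`. -/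
def commonZeros (A : Submodule ℂ (Sym[ℂ]^r V)) : Set (Module.Dual ℂ V) :=
  {f | ∀ a ∈ A, polyEval f a = 0}

open Classical in
/-- The full polarization of an element of `S^r V`: it is fed with a family of `r` linear forms,
indexed by a set `X` of cardinality `r`, and sends `v₁ ⋯ v_r` to
`(1/r!) ∑_{e : {1,…,r} ≃ X} ∏_l φ_{e(l)}(v_l)`. -/
def polarize {X : Type} [Fintype X] (φ : X → Module.Dual ℂ V) : Sym[ℂ]^r V →ₗ[ℂ] ℂ :=
  lift ((r.factorial : ℂ)⁻¹ • ∑ e : Fin r ≃ X,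
      (MultilinearMap.mkPiAlgebra ℂ (Fin r) ℂ).compLinearMap fun l => φ (e l)) (by
    intro s x
    simp only [smul_apply, sum_apply,
      MultilinearMap.compLinearMap_apply, MultilinearMap.mkPiAlgebra_apply]
    congr 1
    refine Fintype.sum_equiv (Equiv.equivCongr s (Equiv.refl X)) _ _ fun e => ?_
    refine Fintype.prod_equiv s _ _ fun l => ?_
    simp [Equiv.equivCongr])

open Classical in
@[simp] theorem polarize_tprod {X : Type} [Fintype X] (φ : X → Module.Dual ℂ V) (x : Fin r → V) :
    polarize φ (SymmetricPower.tprod ℂ x) =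
      (r.factorial : ℂ)⁻¹ * ∑ e : Fin r ≃ X, ∏ l, φ (e l) (x l) := by
  simp [polarize]

theorem polarize_pow {X : Type} [Fintype X] (hX : Fintype.card X = r)
    (φ : X → Module.Dual ℂ V) (x : V) :
    polarize φ (SymmetricPower.tprod ℂ fun _ : Fin r => x) = ∏ a, φ a x := by
  classical
  have h : ∀ e : Fin r ≃ X, ∏ l, φ (e l) x = ∏ a, φ a x := fun e =>
    Equiv.prod_comp e fun a => φ a x
  have hc : Fintype.card (Fin r ≃ X) = r.factorial := by
    rw [Fintype.card_equiv (Fintype.equivFinOfCardEq hX).symm, Fintype.card_fin]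
  rw [polarize_tprod, Finset.sum_congr rfl fun e _ => h e, Finset.sum_const, Finset.card_univ, hc,
    nsmul_eq_mul, inv_mul_cancel_left₀]
  exact_mod_cast r.factorial_ne_zero

end SymPow

/-- A finite directed graph (multiple arrows allowed) with vertices `α_1, …, α_m, β_1, …, β_m` in
which every `α_i` has indegree `0` and outdegree `r` and every `β_j` has indegree `r` and
outdegree `0`. Hence each arrow goes from some `α_i` to some `β_j`; `tail` and `head` give
these indices. -/
structure BiregularGraph (m r : ℕ) where
  Arrow : Type
  [fintypeArrow : Fintype Arrow]
  tail : Arrow → Fin m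
  head : Arrow → Fin m
  card_out : ∀ i, Fintype.card {a // tail a = i} = r
  card_in : ∀ j, Fintype.card {a // head a = j} = r

namespace BiregularGraph

variable {V : Type u} {W : Type v} [AddCommGroup V] [Module ℂ V] [AddCommGroup W] [Module ℂ W]
  [FiniteDimensional ℂ V] {m r : ℕ}

attribute [instance] BiregularGraph.fintypeArrow

open Classical in
/-- The value of the graph `γ` whose arrows are all decorated by `u`, as a function, linear in each
variable, of the decorations `ṽ_i ∈ S^r V` of the `α_i` and `w̃_j ∈ S^r W` of the `β_j`.
The form `u` is contracted along every arrow: with a basis `(b_k)` of `V`, one has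
`u(v ⊗ w) = ∑_k b_k^*(v) u(b_k ⊗ w)`, and the sum runs over all assignments `p` of a basis index
to every arrow. By `value_pow` below, for `ṽ_i = v_i^r`, `w̃_j = w_j^r` it is the product over the
arrows `a` of `u(v_{tail a} ⊗ w_{head a})`. As powers span `S^r V` and `S^r W`, this
determines it. -/
def value (γ : BiregularGraph m r) (u : Module.Dual ℂ (V ⊗[ℂ] W)) :
    MultilinearMap ℂ (fun _ : Fin m => Sym[ℂ]^r V)
      (MultilinearMap ℂ (fun _ : Fin m => Sym[ℂ]^r W) ℂ) :=
  ∑ p : γ.Arrow → Fin (Module.finrank ℂ V),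
    (LinearMap.toSpanSingleton ℂ (MultilinearMap ℂ (fun _ : Fin m => Sym[ℂ]^r W) ℂ)
      ((MultilinearMap.mkPiAlgebra ℂ (Fin m) ℂ).compLinearMap fun j =>
        SymPow.polarize fun a : {a // γ.head a = j} =>
          TensorProduct.curry u (Module.finBasis ℂ V (p a)))).compMultilinearMap
      ((MultilinearMap.mkPiAlgebra ℂ (Fin m) ℂ).compLinearMap fun i =>
        SymPow.polarize fun a : {a // γ.tail a = i} =>
          (Module.finBasis ℂ V).coord (p a))

open Classical in
theorem value_apply (γ : BiregularGraph m r) (u : Module.Dual ℂ (V ⊗[ℂ] W))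
    (x : Fin m → Sym[ℂ]^r V) (y : Fin m → Sym[ℂ]^r W) :
    γ.value u x y = ∑ p : γ.Arrow → Fin (Module.finrank ℂ V),
      (∏ i, SymPow.polarize (fun a : {a // γ.tail a = i} =>
          (Module.finBasis ℂ V).coord (p a)) (x i)) *
      ∏ j, SymPow.polarize (fun a : {a // γ.head a = j} =>
          TensorProduct.curry u (Module.finBasis ℂ V (p a))) (y j) := by
  simp [value]

theorem value_pow (γ : BiregularGraph m r) (u : Module.Dual ℂ (V ⊗[ℂ] W))
    (x : Fin m → V) (y : Fin m → W) :
    γ.value u (fun i => SymmetricPower.tprod ℂ fun _ : Fin r => x i)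
        (fun j => SymmetricPower.tprod ℂ fun _ : Fin r => y j) =
      ∏ a, u (x (γ.tail a) ⊗ₜ[ℂ] y (γ.head a)) := by
  classical
  have key : ∀ (t : γ.Arrow → Fin m) (g : γ.Arrow → Fin m → ℂ),
      ∏ i, ∏ a : {a // t a = i}, g a i = ∏ a, g a (t a) := by
    intro t g
    rw [← Fintype.prod_fiberwise t fun a => g a (t a)]
    exact Finset.prod_congr rfl fun i _ => Finset.prod_congr rfl fun a _ => by rw [a.2]
  have hu : ∀ a, u (x (γ.tail a) ⊗ₜ[ℂ] y (γ.head a)) =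
      ∑ k, (Module.finBasis ℂ V).coord k (x (γ.tail a)) *
        TensorProduct.curry u (Module.finBasis ℂ V k) (y (γ.head a)) := by
    intro a
    conv_lhs => rw [← (Module.finBasis ℂ V).sum_repr (x (γ.tail a))]
    rw [TensorProduct.sum_tmul, map_sum]
    refine Finset.sum_congr rfl fun k _ => ?_
    rw [← TensorProduct.smul_tmul', map_smul]
    rfl
  rw [value_apply, Finset.prod_congr rfl fun a _ => hu a, Finset.prod_univ_sum]
  simp only [Fintype.piFinset_univ]
  refine Finset.sum_congr rfl fun p _ => ?_
  rw [Finset.prod_mul_distrib]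
  simp only [SymPow.polarize_pow (γ.card_out _), SymPow.polarize_pow (γ.card_in _)]
  rw [key γ.tail fun a i => (Module.finBasis ℂ V).coord (p a) (x i),
    key γ.head fun a j => TensorProduct.curry u (Module.finBasis ℂ V (p a)) (y j)]

end BiregularGraph

end

/-!
Write `u` as `∑_{i < n} φ_i ⊗ ψ_i` with independent `φ_i` and independent `ψ_i`, where `n` is the
rank of `u`. Restricted to the linear combinations of the `φ_i`, the elements of `A` become forms
`P(g)` of degree `r` in `n` variables whose only common zero is the origin (`symPoly`); likewise `B`
gives forms `Q(h)`.

The sum of the values of all the graphs obtained by joining the half-arrows at the `α_i` to those at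
the `β_j` by a permutation is the apolar pairing `(∏ P_i)(∂) (∏ Q_j)` (`sum_value_permGraph`): on
powers both sides are permanents, and powers span the symmetric power. It is therefore enough to
find `m > 0` such that the `m`-fold products of elements of `A` are not all orthogonal to those of
elements of `B`, with `m` bounded.

Regard the pairing as a linear functional `L` on the polynomials in `g` and `h`, and consider the
invariant form `t = ∑ g_i h_i`. By Euler's identity `L (t F)` is a positive multiple of `L F` if `F`
is homogeneous in `h` (`apolar_pairingForm_mul`); in particular `L (t ^ s) ≠ 0`. By the
Nullstellensatz, if `E` denotes the space of forms of bidegree `(k, k)` with `k` large, then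
`t ^ r E ⊆ R E`, where `R` is spanned by the products `P Q`
(`exists_forall_homogeneousSubmodule_le_mul`). Hence `det (t ^ r - ρ) = 0` for a matrix `ρ` with
entries in `R`. If `L` vanished on `R ^ m` for all `m > 0`, it would vanish on all terms
of the expanded determinant other than the power of `t`, hence also on that power, a contradiction
(`exists_apolar_mul_ne_zero`).

The pairings of products of forms are polynomials in the coefficients of the forms. As the ring of
these polynomials is Noetherian, finitely many `m` suffice for all `A` and `B` at once
(`exists_bound_apolar_prod_ne_zero`), for each of the finitely many possible ranks of `u`.
-/

noncomputable section

open MvPolynomial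

/-! ### The apolar functional -/

section Apolar

variable {ι : Type*} [Fintype ι] {K L : Type*} [CommRing K] [CommRing L]

/-- The value of the apolar functional at the monomial `g ^ α h ^ β`, where `α` and `β` are the
restrictions of `s` to the two copies of `ι`: it is `α!` if `α = β` and `0` otherwise. -/
def apolarWeight (s : ι ⊕ ι →₀ ℕ) : ℕ :=
  if ∀ i, s (.inl i) = s (.inr i) then ∏ i, (s (.inl i)).factorial else 0

theorem apolarWeight_add_single_add_single (s : ι ⊕ ι →₀ ℕ) (i : ι) :
    apolarWeight (s + Finsupp.single (.inr i) 1 + Finsupp.single (.inl i) 1) =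
      (s (.inr i) + 1) * apolarWeight s := by
  classical
  have key : ∀ j, (s + Finsupp.single (.inr i) 1 + Finsupp.single (.inl i) 1 : ι ⊕ ι →₀ ℕ)
      (.inl j) = s (Sum.inl j) + if j = i then 1 else 0 := by
    intro j
    by_cases h : j = i <;> simp [h]
  have key' : ∀ j, (s + Finsupp.single (.inr i) 1 + Finsupp.single (.inl i) 1 : ι ⊕ ι →₀ ℕ)
      (.inr j) = s (Sum.inr j) + if j = i then 1 else 0 := by
    intro j
    by_cases h : j = i <;> simp [h]
  unfold apolarWeight
  simp only [key, key', add_left_inj]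
  split_ifs with h
  · have : ∀ j, (s (.inl j) + if j = i then 1 else 0).factorial =
        (if j = i then s (.inl j) + 1 else 1) * (s (.inl j)).factorial := by
      intro j
      by_cases hj : j = i <;> simp [hj, Nat.factorial_succ]
    simp only [this, Finset.prod_mul_distrib, Finset.prod_ite_eq', Finset.mem_univ, if_true, h i]
  · simp

theorem apolarWeight_add_single (s : ι ⊕ ι →₀ ℕ) (i : ι) :
    apolarWeight (s + Finsupp.single (.inl i) 1) =
      s (.inr i) * apolarWeight (s - Finsupp.single (.inr i) 1) := by
  rcases Nat.eq_zero_or_pos (s (.inr i)) with h | h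
  · rw [h, zero_mul, apolarWeight, if_neg]
    intro hs
    simpa [h] using hs i
  · obtain ⟨s', rfl⟩ : ∃ s', s = s' + Finsupp.single (.inr i) 1 :=
      ⟨s - Finsupp.single (.inr i) 1, (tsub_add_cancel_of_le (Finsupp.single_le_iff.2 h)).symm⟩
    rw [apolarWeight_add_single_add_single]
    simp

variable (ι K) in
/-- The apolar pairing `(P, Q) ↦ P(∂) Q` of polynomials in the variables `ι`, as a functional on the
polynomials `F(g, h)` in two sets of variables: its value at `P(g) Q(h)` is the constant term of
`P(∂) Q`. -/
def apolar : MvPolynomial (ι ⊕ ι) K →ₗ[K] K :=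
  (basisMonomials (ι ⊕ ι) K).constr K fun s => (apolarWeight s : K)

theorem apolar_monomial (s : ι ⊕ ι →₀ ℕ) (a : K) :
    apolar ι K (monomial s a) = a * apolarWeight s := by
  have h : monomial s a = a • basisMonomials (ι ⊕ ι) K s := by
    simp [smul_monomial]
  rw [h, map_smul, apolar, Module.Basis.constr_basis, smul_eq_mul]

@[simp] theorem apolar_one : apolar ι K 1 = 1 := by
  rw [← C_1, ← monomial_zero', apolar_monomial]
  simp [apolarWeight]

theorem apolar_map (φ : K →+* L) (F : MvPolynomial (ι ⊕ ι) K) :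
    apolar ι L (map φ F) = φ (apolar ι K F) := by
  induction F using MvPolynomial.induction_on' with
  | monomial s a => simp [apolar_monomial]
  | add p q hp hq => simp [hp, hq]

/-- Under the apolar functional, multiplication by `g_i` is the transpose of `∂/∂h_i`. -/
theorem apolar_X_mul (i : ι) (F : MvPolynomial (ι ⊕ ι) K) :
    apolar ι K (X (.inl i) * F) = apolar ι K (pderiv (.inr i) F) := by
  induction F using MvPolynomial.induction_on' with
  | monomial s a =>
    rw [pderiv_monomial, mul_comm, X, monomial_mul, mul_one, apolar_monomial, apolar_monomial,
      apolarWeight_add_single]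
    push_cast
    ring
  | add p q hp hq => simp [mul_add, hp, hq]

variable (ι K) in
/-- The invariant quadratic form `t = ∑ g_i h_i`. -/
def pairingForm : MvPolynomial (ι ⊕ ι) K := ∑ i, X (.inl i) * X (.inr i)

/-- By Euler's identity, multiplication by `t` scales the apolar functional on polynomials of given
degree in the second set of variables `h`, to which the weight `Sum.elim 0 1` gives degree one. -/
theorem apolar_pairingForm_mul {n : ℕ} {F : MvPolynomial (ι ⊕ ι) K}
    (hF : IsWeightedHomogeneous (Sum.elim 0 1 : ι ⊕ ι → ℕ) F n) :
    apolar ι K (pairingForm ι K * F) = (Fintype.card ι + n : ℕ) * apolar ι K F := by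
  have euler := hF.sum_weight_X_mul_pderiv
  simp only [Fintype.sum_sum_type, Sum.elim_inl, Sum.elim_inr, Pi.zero_apply, Pi.one_apply,
    zero_smul, Finset.sum_const_zero, zero_add, one_smul] at euler
  rw [pairingForm, Finset.sum_mul, map_sum]
  simp only [mul_assoc, apolar_X_mul, Derivation.leibniz, pderiv_X_self, smul_eq_mul, mul_one,
    map_add]
  rw [Finset.sum_add_distrib, ← map_sum, euler, map_nsmul]
  simp [add_comm, add_mul]

theorem isWeightedHomogeneous_pairingForm :
    IsWeightedHomogeneous (Sum.elim 0 1 : ι ⊕ ι → ℕ) (pairingForm ι K) 1 := by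
  refine IsWeightedHomogeneous.sum _ _ _ fun i _ => ?_
  exact (isWeightedHomogeneous_X K (Sum.elim 0 1 : ι ⊕ ι → ℕ) (.inl i)).mul
    (isWeightedHomogeneous_X K (Sum.elim 0 1 : ι ⊕ ι → ℕ) (.inr i))

theorem apolar_pairingForm_pow_mul {n : ℕ} {F : MvPolynomial (ι ⊕ ι) K}
    (hF : IsWeightedHomogeneous (Sum.elim 0 1 : ι ⊕ ι → ℕ) F n) (s : ℕ) :
    apolar ι K (pairingForm ι K ^ s * F) =
      (∏ j ∈ Finset.range s, (Fintype.card ι + n + j) : ℕ) * apolar ι K F := by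
  induction s with
  | zero => simp
  | succ s ih =>
    have h : IsWeightedHomogeneous (Sum.elim 0 1 : ι ⊕ ι → ℕ) (pairingForm ι K ^ s * F)
        (s + n) := by
      simpa using (isWeightedHomogeneous_pairingForm.pow s).mul hF
    rw [pow_succ', mul_assoc, apolar_pairingForm_mul h, ih, Finset.prod_range_succ]
    push_cast
    ring

theorem apolar_pairingForm_pow_ne_zero [Nonempty ι] [CharZero K] (s : ℕ) :
    apolar ι K (pairingForm ι K ^ s) ≠ 0 := by
  have h := apolar_pairingForm_pow_mul (isWeightedHomogeneous_one K (Sum.elim 0 1 : ι ⊕ ι → ℕ)) s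
  rw [mul_one, apolar_one, mul_one] at h
  rw [h, Nat.cast_ne_zero, Finset.prod_ne_zero_iff]
  have := Fintype.card_pos (α := ι)
  intro j _
  omega

/-- The linear form `∑ c_i X_{f i}`. -/
def linearForm {κ : Type*} (f : ι → κ) (c : ι → K) : MvPolynomial κ K := ∑ i, C (c i) * X (f i)

theorem apolar_linearForm_mul (c : ι → K) (F : MvPolynomial (ι ⊕ ι) K) :
    apolar ι K (linearForm .inl c * F) = ∑ i, c i * apolar ι K (pderiv (.inr i) F) := by
  simp only [linearForm, Finset.sum_mul, map_sum, ← apolar_X_mul, C_mul', map_smul,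
    smul_mul_assoc, smul_eq_mul]

theorem pderiv_linearForm_inr (e : ι → K) (i : ι) :
    pderiv (.inr i) (linearForm (.inr : ι → ι ⊕ ι) e) = C (e i) := by
  classical
  simp [linearForm, pderiv_X, Pi.single_apply]

theorem pderiv_linearForm_inl (e : ι → K) (i : ι) :
    pderiv (.inr i) (linearForm (.inl : ι → ι ⊕ ι) e) = 0 := by
  classical
  simp [linearForm, pderiv_X]

/-- Leibniz rule for a product of linear forms. -/
theorem pderiv_prod_linearForm {β : Type*} [DecidableEq β] (s : Finset β) (e : β → ι → K) (i : ι) :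
    pderiv (.inr i) (∏ b ∈ s, linearForm (.inr : ι → ι ⊕ ι) (e b)) =
      ∑ b ∈ s, C (e b i) * ∏ b' ∈ s.erase b, linearForm (.inr : ι → ι ⊕ ι) (e b') := by
  induction s using Finset.induction_on with
  | empty => simp
  | insert a s ha ih =>
    rw [Finset.prod_insert ha, Derivation.leibniz, ih, pderiv_linearForm_inr,
      Finset.sum_insert ha, Finset.erase_insert ha, add_comm, smul_eq_mul, smul_eq_mul, mul_comm,
      Finset.mul_sum]
    congr 1
    refine Finset.sum_congr rfl fun b hb => ?_
    have hab : a ≠ b := fun h => ha (h ▸ hb)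
    rw [Finset.erase_insert_of_ne hab, Finset.prod_insert (by simp [ha])]
    ring

theorem pderiv_prod_linearForm_inl {β : Type*} (s : Finset β) (c : β → ι → K) (i : ι) :
    pderiv (.inr i) (∏ b ∈ s, linearForm (.inl : ι → ι ⊕ ι) (c b)) = 0 := by
  classical
  induction s using Finset.induction_on with
  | empty => simp
  | insert a s ha ih =>
    rw [Finset.prod_insert ha, Derivation.leibniz, ih, pderiv_linearForm_inl]
    simp

/-- The apolar pairing of two products of linear forms is a permanent. -/
theorem apolar_prod_linearForm_fin (n : ℕ) (c e : Fin n → ι → K) :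
    apolar ι K ((∏ a, linearForm .inl (c a)) * ∏ b, linearForm .inr (e b)) =
      ∑ σ : Equiv.Perm (Fin n), ∏ a, ∑ i, c a i * e (σ a) i := by
  classical
  induction n with
  | zero => simp
  | succ n ih =>
    have herase : ∀ p : Fin (n + 1), ∏ b ∈ Finset.univ.erase p,
        linearForm (.inr : ι → ι ⊕ ι) (e b) =
          ∏ b : Fin n, linearForm .inr (e (Equiv.swap 0 p b.succ)) := by
      intro p
      refine Eq.trans ?_ (Finset.prod_map Finset.univ
        ((Fin.succEmb n).trans (Equiv.swap 0 p).toEmbedding)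
        fun b => linearForm (.inr : ι → ι ⊕ ι) (e b))
      congr 1
      ext b
      simp only [Finset.mem_erase, Finset.mem_univ, and_true, Finset.mem_map, true_and]
      constructor
      · intro hb
        have h0 : Equiv.swap 0 p b ≠ 0 := by
          intro h
          apply hb
          rw [← Equiv.swap_apply_self 0 p b, h, Equiv.swap_apply_left]
        obtain ⟨j, hj⟩ := Fin.exists_succ_eq.2 h0
        exact ⟨j, by simp [hj]⟩
      · rintro ⟨j, rfl⟩ h
        have := congrArg (Equiv.swap 0 p) h
        simp at this
    rw [Fin.prod_univ_succ, mul_assoc, apolar_linearForm_mul]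
    simp only [Derivation.leibniz, pderiv_prod_linearForm_inl, add_zero,
      pderiv_prod_linearForm, smul_eq_mul, mul_zero, Finset.mul_sum, map_sum, herase]
    -- Differentiating along the first form of the left product singles out a factor `p` of the right
    -- product: this is the expansion of the permanent along its first row.
    rw [← Equiv.sum_comp Equiv.Perm.decomposeFin.symm, Fintype.sum_prod_type, Finset.sum_comm]
    refine Finset.sum_congr rfl fun p _ => ?_
    simp only [Fin.prod_univ_succ, Equiv.Perm.decomposeFin_symm_apply_zero,
      Equiv.Perm.decomposeFin_symm_apply_succ]
    rw [← Finset.mul_sum, ← ih (fun a => c a.succ) fun b => e (Equiv.swap 0 p b.succ),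
      Finset.sum_mul]
    refine Finset.sum_congr rfl fun i _ => ?_
    rw [mul_left_comm, C_mul', map_smul, smul_eq_mul, mul_assoc]

theorem apolar_prod_linearForm {β : Type*} [Fintype β] [DecidableEq β] (c e : β → ι → K) :
    apolar ι K ((∏ a, linearForm .inl (c a)) * ∏ b, linearForm .inr (e b)) =
      ∑ σ : Equiv.Perm β, ∏ a, ∑ i, c a i * e (σ a) i := by
  let f := (Fintype.equivFin β).symm
  rw [← Equiv.prod_comp f, ← Equiv.prod_comp f fun b => linearForm (.inr : ι → ι ⊕ ι) (e b),
    apolar_prod_linearForm_fin, ← Equiv.sum_comp f.permCongr]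
  refine Finset.sum_congr rfl fun σ _ => ?_
  rw [← Equiv.prod_comp f fun a => ∑ i, c a i * e (f.permCongr σ a) i]
  simp [Equiv.permCongr_apply]

end Apolar

/-! ### Symmetric powers and polynomials -/

section SymmetricPowers

variable {V : Type u} [AddCommGroup V] [Module ℂ V] {r : ℕ}

/-- The linear map from the symmetric power `S^r V` to a module induced by a symmetric multilinear
map. -/
def symLift {N : Type*} [AddCommGroup N] [Module ℂ N] (f : MultilinearMap ℂ (fun _ : Fin r => V) N)
    (hf : ∀ (e : Equiv.Perm (Fin r)) (x : Fin r → V), f (fun i => x (e i)) = f x) :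
    Sym[ℂ]^r V →ₗ[ℂ] N where
  toFun := AddCon.lift _ (PiTensorProduct.lift f).toAddMonoidHom (by
    refine AddCon.addConGen_le.2 ?_
    rintro _ _ ⟨e, x⟩
    rw [AddCon.ker_rel]
    simp [hf])
  map_add' := map_add _
  map_smul' c x := by
    induction x using AddCon.induction_on with
    | H x => exact (PiTensorProduct.lift f).map_smul c x

@[simp] theorem symLift_tprod {N : Type*} [AddCommGroup N] [Module ℂ N]
    (f : MultilinearMap ℂ (fun _ : Fin r => V) N)
    (hf : ∀ (e : Equiv.Perm (Fin r)) (x : Fin r → V), f (fun i => x (e i)) = f x)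
    (x : Fin r → V) : symLift f hf (SymmetricPower.tprod ℂ x) = f x := by
  change PiTensorProduct.lift f (PiTensorProduct.tprod ℂ x) = f x
  simp

theorem sym_linearMap_ext {N : Type*} [AddCommGroup N] [Module ℂ N] {f g : Sym[ℂ]^r V →ₗ[ℂ] N}
    (h : ∀ x : Fin r → V, f (SymmetricPower.tprod ℂ x) = g (SymmetricPower.tprod ℂ x)) : f = g :=
  LinearMap.ext_on_range (SymmetricPower.span_tprod_eq_top ℂ (Fin r) V) h

/-- The powers `v ^ r` span `S^r V`: otherwise some nonzero linear form vanishes at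
`(∑ c_l x_l) ^ r` for all `c`, and the coefficient of `c_1 ⋯ c_r` gives its value at
`r! x_1 ⋯ x_r`. -/
theorem span_range_pow_eq_top :
    Submodule.span ℂ (Set.range fun v : V => SymmetricPower.tprod ℂ fun _ : Fin r => v) = ⊤ := by
  classical
  by_contra hne
  obtain ⟨L, hL0, hL⟩ := Submodule.exists_le_ker_of_lt_top _ (lt_top_iff_ne_top.2 hne)
  apply hL0
  refine sym_linearMap_ext fun x => ?_
  have hpow : ∀ v : V, L (SymmetricPower.tprod ℂ fun _ : Fin r => v) = 0 := fun v =>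
    hL (Submodule.subset_span ⟨v, rfl⟩)
  -- `F` is the polynomial `c ↦ L ((∑ c_l x_l) ^ r)`.
  let F : MvPolynomial (Fin r) ℂ := ∑ τ : Fin r → Fin r,
    C (L (SymmetricPower.tprod ℂ fun l => x (τ l))) * ∏ l, X (τ l)
  have hF : F = 0 := by
    refine MvPolynomial.funext fun c => ?_
    have h := hpow (∑ l, c l • x l)
    rw [MultilinearMap.map_sum] at h
    simp only [MultilinearMap.map_smul_univ, map_sum, map_smul, smul_eq_mul] at h
    simp only [F, map_sum, map_mul, map_prod, eval_C, eval_X, map_zero]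
    rw [← h]
    exact Finset.sum_congr rfl fun τ _ => mul_comm _ _
  let s : Fin r →₀ ℕ := ∑ l, Finsupp.single l 1
  have hmon : ∀ τ : Fin r → Fin r, (∏ l, X (τ l) : MvPolynomial (Fin r) ℂ) =
      monomial (∑ l, Finsupp.single (τ l) 1) 1 := by
    exact fun τ => (monomial_sum_one Finset.univ fun l => Finsupp.single (τ l) 1).symm
  have hcoeff := congrArg (coeff s) hF
  simp only [F, coeff_sum, coeff_C_mul, hmon, coeff_monomial, coeff_zero, mul_ite, mul_one,
    mul_zero] at hcoeff
  -- Only the permutations `τ` contribute to the coefficient of `c_1 ⋯ c_r`.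
  have hperm : ∀ τ : Fin r → Fin r, ∑ l, Finsupp.single (τ l) 1 = s →
      L (SymmetricPower.tprod ℂ fun l => x (τ l)) = L (SymmetricPower.tprod ℂ x) := by
    intro τ hτ
    have hsurj : Function.Surjective τ := by
      intro j
      by_contra! hj
      have h := DFunLike.congr_fun hτ j
      simp [s, Finsupp.finsetSum_apply, Finsupp.single_apply, hj] at h
    let e : Equiv.Perm (Fin r) := Equiv.ofBijective τ (Finite.surjective_iff_bijective.1 hsurj)
    exact congrArg L (SymmetricPower.tprod_equiv e x)
  have hterm : ∀ τ : Fin r → Fin r, (if ∑ l, Finsupp.single (τ l) 1 = s then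
      L (SymmetricPower.tprod ℂ fun l => x (τ l)) else 0) =
      if ∑ l, Finsupp.single (τ l) 1 = s then L (SymmetricPower.tprod ℂ x) else 0 := by
    intro τ
    split_ifs with h
    exacts [hperm τ h, rfl]
  rw [Finset.sum_congr rfl fun τ _ => hterm τ, ← Finset.sum_filter, Finset.sum_const,
    smul_eq_zero] at hcoeff
  refine hcoeff.resolve_left (Finset.card_ne_zero_of_mem (a := id) ?_)
  simp [s]

variable {ι : Type*} [Fintype ι]

/-- The linear map `V → ℂ[X_i]` sending `v` to the linear form `∑ φ_i(v) X_i`. -/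
def linearFormMap (φ : ι → Module.Dual ℂ V) : V →ₗ[ℂ] MvPolynomial ι ℂ :=
  ∑ i, (φ i).smulRight (X i)

theorem linearFormMap_apply (φ : ι → Module.Dual ℂ V) (v : V) :
    linearFormMap φ v = linearForm id fun i => φ i v := by
  simp [linearFormMap, linearForm, C_mul']

/-- The polynomial map `V* → ℂ` given by an element of `S^r V`, restricted to the linear
combinations `∑ g_i φ_i` and written as a polynomial in the coordinates `g_i`. -/
def symPoly (φ : ι → Module.Dual ℂ V) : Sym[ℂ]^r V →ₗ[ℂ] MvPolynomial ι ℂ :=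
  symLift ((MultilinearMap.mkPiAlgebra ℂ (Fin r) (MvPolynomial ι ℂ)).compLinearMap
    fun _ => linearFormMap φ) (by
      intro e x
      simpa using Equiv.prod_comp e fun i => linearFormMap φ (x i))

@[simp] theorem symPoly_tprod (φ : ι → Module.Dual ℂ V) (x : Fin r → V) :
    symPoly φ (SymmetricPower.tprod ℂ x) = ∏ l, linearForm id fun i => φ i (x l) := by
  simp [symPoly, linearFormMap_apply]

theorem eval_symPoly (φ : ι → Module.Dual ℂ V) (g : ι → ℂ) (x : Sym[ℂ]^r V) :
    eval g (symPoly φ x) = SymPow.polyEval (∑ i, g i • φ i) x := by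
  have h : (aeval g).toLinearMap ∘ₗ symPoly φ = SymPow.polyEval (r := r) (∑ i, g i • φ i) := by
    refine sym_linearMap_ext fun x => ?_
    simp only [LinearMap.comp_apply, symPoly_tprod, SymPow.polyEval_tprod, AlgHom.toLinearMap_apply,
      map_prod]
    refine Finset.prod_congr rfl fun l _ => ?_
    simp [linearForm, mul_comm]
  simpa [coe_aeval_eq_eval] using LinearMap.congr_fun h x

theorem symPoly_isHomogeneous (φ : ι → Module.Dual ℂ V) (x : Sym[ℂ]^r V) :
    (symPoly φ x).IsHomogeneous r := by
  rw [← mem_homogeneousSubmodule]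
  have hx : x ∈ Submodule.span ℂ (Set.range (SymmetricPower.tprod ℂ (ι := Fin r) (M := V))) := by
    rw [SymmetricPower.span_tprod_eq_top]
    trivial
  refine (Submodule.span_le (p := (homogeneousSubmodule ι ℂ r).comap (symPoly φ))).2 ?_ hx
  rintro _ ⟨y, rfl⟩
  change symPoly φ (SymmetricPower.tprod ℂ y) ∈ homogeneousSubmodule ι ℂ r
  rw [symPoly_tprod, mem_homogeneousSubmodule]
  have := IsHomogeneous.prod Finset.univ
    (fun l : Fin r => linearForm id fun i => φ i (y l)) (fun _ => 1) fun l _ =>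
      IsHomogeneous.sum _ _ _ fun i _ => isHomogeneous_C_mul_X _ _
  simpa using this

end SymmetricPowers

/-! ### Sums over graphs -/

/-- The graph whose arrows are the pairs `(i, s)`, the `s`-th half-arrow at `α_i` being joined to
the half-arrow `σ (i, s)` at `β_j`, `j = (σ (i, s)).1`. -/
def permGraph {m r : ℕ} (σ : Equiv.Perm (Fin m × Fin r)) : BiregularGraph m r where
  Arrow := Fin m × Fin r
  tail := Prod.fst
  head a := (σ a).1
  card_out i := by
    rw [Fintype.card_congr (Equiv.prodSubtypeFstEquivSubtypeProd (p := (· = i)))]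
    simp
  card_in j := by
    rw [Fintype.card_congr ((σ.subtypeEquiv (p := fun a => (σ a).1 = j) (q := fun a => a.1 = j)
      fun _ => Iff.rfl).trans (Equiv.prodSubtypeFstEquivSubtypeProd (p := (· = j))))]
    simp

section GraphSum

variable {V : Type u} {W : Type v} [AddCommGroup V] [Module ℂ V] [AddCommGroup W] [Module ℂ W]
  [FiniteDimensional ℂ V] {m r : ℕ} {ι : Type*} [Fintype ι]

theorem rename_linearForm {κ : Type*} (f : ι → κ) (c : ι → ℂ) :
    rename f (linearForm id c) = linearForm f c := by
  simp [linearForm]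

/-- Summed over all ways of joining the half-arrows, the values of the graphs give the apolar
pairing of the product of the `P_i` with the product of the `Q_j`. -/
theorem sum_value_permGraph (u : Module.Dual ℂ (V ⊗[ℂ] W)) (φ : ι → Module.Dual ℂ V)
    (ψ : ι → Module.Dual ℂ W) (hu : ∀ v w, u (v ⊗ₜ w) = ∑ i, φ i v * ψ i w)
    (x : Fin m → Sym[ℂ]^r V) (y : Fin m → Sym[ℂ]^r W) :
    ∑ σ : Equiv.Perm (Fin m × Fin r), (permGraph σ).value u x y =
      apolar ι ℂ ((∏ i, rename Sum.inl (symPoly φ (x i))) *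
        ∏ j, rename Sum.inr (symPoly ψ (y j))) := by
  let P : Sym[ℂ]^r V →ₗ[ℂ] MvPolynomial (ι ⊕ ι) ℂ := (rename Sum.inl).toLinearMap ∘ₗ symPoly φ
  let Q : Sym[ℂ]^r W →ₗ[ℂ] MvPolynomial (ι ⊕ ι) ℂ := (rename Sum.inr).toLinearMap ∘ₗ symPoly ψ
  let MQ : MultilinearMap ℂ (fun _ : Fin m => Sym[ℂ]^r W) (MvPolynomial (ι ⊕ ι) ℂ) :=
    (MultilinearMap.mkPiAlgebra ℂ (Fin m) _).compLinearMap fun _ => Q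
  let MP : MultilinearMap ℂ (fun _ : Fin m => Sym[ℂ]^r V) (MvPolynomial (ι ⊕ ι) ℂ) :=
    (MultilinearMap.mkPiAlgebra ℂ (Fin m) _).compLinearMap fun _ => P
  let T : MvPolynomial (ι ⊕ ι) ℂ →ₗ[ℂ] MultilinearMap ℂ (fun _ : Fin m => Sym[ℂ]^r W) ℂ :=
    { toFun := fun F => ((apolar ι ℂ) ∘ₗ LinearMap.mulLeft ℂ F).compMultilinearMap MQ
      map_add' := fun F G => by ext; simp [add_mul]
      map_smul' := fun c F => by ext; simp }
  -- Both sides are multilinear in `x` and in `y`, so it suffices to compare them on powers.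
  have key : ∑ σ : Equiv.Perm (Fin m × Fin r), (permGraph σ).value u = T.compMultilinearMap MP := by
    refine MultilinearMap.ext_of_span_eq_top (fun _ => span_range_pow_eq_top) fun v => ?_
    refine MultilinearMap.ext_of_span_eq_top (fun _ => span_range_pow_eq_top) fun w => ?_
    have h := apolar_prod_linearForm (β := Fin m × Fin r) (fun a i => φ i (v a.1))
      fun b i => ψ i (w b.1)
    simp only [sum_apply, BiregularGraph.value_pow, hu]
    refine Eq.trans ?_ (h.symm.trans ?_)
    · rfl
    · simp [T, MP, MQ, P, Q, Fintype.prod_prod_type, rename_linearForm]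
  have h := DFunLike.congr_fun (DFunLike.congr_fun key x) y
  simpa [T, MP, MQ, P, Q] using h

end GraphSum

/-! ### Homogeneous polynomials without common zeros -/

section Nullstellensatz

variable {ι : Type*} {r : ℕ}

/-- A homogeneous element of the ideal generated by a space `A` of forms has homogeneous
coefficients over `A`. -/
theorem homogeneousComponent_mem_mul_of_mem_span {A : Submodule ℂ (MvPolynomial ι ℂ)}
    (hA : A ≤ homogeneousSubmodule ι ℂ r) (n : ℕ) {F : MvPolynomial ι ℂ}
    (hF : F ∈ Ideal.span (A : Set (MvPolynomial ι ℂ))) :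
    homogeneousComponent (n + r) F ∈ A * homogeneousSubmodule ι ℂ n := by
  suffices h : ∀ c, homogeneousComponent (n + r) (c * F) ∈ A * homogeneousSubmodule ι ℂ n by
    simpa using h 1
  induction hF using Submodule.span_induction with
  | mem x hx =>
    intro c
    induction c using MvPolynomial.induction_on' with
    | monomial s a =>
      have hs : (monomial s a).IsHomogeneous s.degree := isHomogeneous_monomial a rfl
      rw [homogeneousComponent_of_mem (hs.mul (hA hx))]
      split_ifs with h
      · rw [mul_comm (monomial s a) x]
        have hn : s.degree = n := by omega
        exact Submodule.mul_mem_mul hx (hn ▸ hs)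
      · exact zero_mem _
    | add p q hp hq =>
      rw [add_mul, map_add]
      exact add_mem hp hq
  | zero => simp
  | add x y _ _ hx hy =>
    intro c
    rw [mul_add, map_add]
    exact add_mem (hx c) (hy c)
  | smul a x _ hx =>
    intro c
    rw [smul_eq_mul, ← mul_assoc]
    exact hx (c * a)

/-- Homogeneous Nullstellensatz: forms of degree `r` whose only common zero is the origin
generate all forms of sufficiently large degree. -/
theorem exists_forall_homogeneousSubmodule_le_mul [Finite ι] [Nonempty ι]
    {A : Submodule ℂ (MvPolynomial ι ℂ)} (hA : A ≤ homogeneousSubmodule ι ℂ r)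
    (hA0 : ∀ g : ι → ℂ, (∀ p ∈ A, eval g p = 0) → g = 0) :
    ∃ n₀, ∀ n ≥ n₀, homogeneousSubmodule ι ℂ (n + r) ≤ A * homogeneousSubmodule ι ℂ n := by
  have := Fintype.ofFinite ι
  set I := Ideal.span (A : Set (MvPolynomial ι ℂ)) with hI
  have hX : ∀ i, ∃ N, (X i : MvPolynomial ι ℂ) ^ N ∈ I := by
    intro i
    change X i ∈ I.radical
    rw [← vanishingIdeal_zeroLocus_eq_radical (K := ℂ), mem_vanishingIdeal_iff]
    intro g hg
    have : g = 0 := hA0 g fun p hp => by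
      simpa [coe_aeval_eq_eval] using hg p (Ideal.subset_span hp)
    simp [this]
  choose N hN using hX
  refine ⟨∑ i, N i, fun n hn => ?_⟩
  intro F hF
  have hFI : F ∈ I := by
    rw [F.as_sum]
    refine sum_mem fun s hs => ?_
    have hdeg : s.degree = n + r := by
      by_contra h
      exact (mem_support_iff.1 hs) (IsHomogeneous.coeff_eq_zero hF h)
    obtain ⟨i, hi⟩ : ∃ i, N i ≤ s i := by
      by_contra! h
      have := Finset.sum_lt_sum_of_nonempty Finset.univ_nonempty fun i _ => h i
      rw [Finsupp.degree_eq_sum] at hdeg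
      omega
    have hmon : monomial s (coeff s F) =
        monomial (s - Finsupp.single i (N i)) (coeff s F) * X i ^ N i := by
      rw [X_pow_eq_monomial, monomial_mul, mul_one,
        tsub_add_cancel_of_le (Finsupp.single_le_iff.2 hi)]
    rw [hmon]
    exact I.mul_mem_left _ (hN i)
  have h := homogeneousComponent_mem_mul_of_mem_span hA n hFI
  rwa [homogeneousComponent_of_mem hF, if_pos rfl] at h

end Nullstellensatz

/-! ### Integral dependence of the invariant form -/

section Integrality

variable {ι : Type*} {r : ℕ}

theorem pow_le_homogeneousSubmodule {A : Submodule ℂ (MvPolynomial ι ℂ)}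
    (hA : A ≤ homogeneousSubmodule ι ℂ r) (m : ℕ) : A ^ m ≤ homogeneousSubmodule ι ℂ (r * m) := by
  refine (pow_le_pow_left' hA m).trans ?_
  rw [← homogeneousSubmodule_one_pow, ← pow_mul, homogeneousSubmodule_one_pow]

theorem map_rename_homogeneousSubmodule_le {κ : Type*} (f : ι → κ) (w : κ → ℕ) (k : ℕ)
    (hw : ∀ i, w (f i) = k) (n : ℕ) :
    (homogeneousSubmodule ι ℂ n).map (rename (R := ℂ) f).toLinearMap ≤
      weightedHomogeneousSubmodule ℂ w (n * k) := by
  rw [← homogeneousSubmodule_one_pow, Submodule.map_pow]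
  induction n with
  | zero =>
    rw [pow_zero, zero_mul, Submodule.one_le]
    exact isWeightedHomogeneous_one ℂ w
  | succ n ih =>
    rw [pow_succ, add_mul, one_mul]
    refine (mul_le_mul' ih ?_).trans (weightedHomogeneousSubmodule_mul w _ _)
    rw [homogeneousSubmodule_one_eq_span_X, Submodule.map_span, Submodule.span_le]
    rintro _ ⟨_, ⟨i, rfl⟩, rfl⟩
    simpa [hw] using isWeightedHomogeneous_X ℂ w (f i)

variable [Fintype ι]

/-- `t ^ n` is a sum of products of a form of degree `n` in `g` and one in `h`. -/
theorem pairingForm_pow_mem (n : ℕ) :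
    pairingForm ι ℂ ^ n ∈
      (homogeneousSubmodule ι ℂ n).map (rename (R := ℂ) Sum.inl).toLinearMap *
        (homogeneousSubmodule ι ℂ n).map (rename (R := ℂ) Sum.inr).toLinearMap := by
  rw [← homogeneousSubmodule_one_pow, Submodule.map_pow, Submodule.map_pow, ← mul_pow]
  refine Submodule.pow_mem_pow _ ?_ n
  refine sum_mem fun i _ => Submodule.mul_mem_mul ⟨X i, isHomogeneous_X ℂ i, ?_⟩
    ⟨X i, isHomogeneous_X ℂ i, ?_⟩ <;> simp

theorem prod_mem_pow_card {R S κ : Type*} [CommSemiring R] [CommSemiring S] [Algebra R S]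
    (M : Submodule R S) (s : Finset κ) (f : κ → S) (hf : ∀ i ∈ s, f i ∈ M) :
    ∏ i ∈ s, f i ∈ M ^ s.card := by
  classical
  induction s using Finset.induction_on with
  | empty => simp [Submodule.one_le.1 le_rfl]
  | insert a s ha ih =>
    rw [Finset.prod_insert ha, Finset.card_insert_of_notMem ha, pow_succ']
    exact Submodule.mul_mem_mul (hf a (Finset.mem_insert_self a s))
      (ih fun i hi => hf i (Finset.mem_insert_of_mem hi))

theorem exists_sum_mul_of_mem_mul_span {R S κ : Type*} [CommSemiring R] [CommSemiring S]
    [Algebra R S] [Fintype κ] (M : Submodule R S) (e : κ → S) {F : S}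
    (hF : F ∈ M * Submodule.span R (Set.range e)) :
    ∃ c : κ → S, (∀ j, c j ∈ M) ∧ F = ∑ j, c j * e j := by
  induction hF using Submodule.mul_induction_on' with
  | mem_mul_mem a ha b hb =>
    obtain ⟨c, rfl⟩ := (Submodule.mem_span_range_iff_exists_fun R).1 hb
    refine ⟨fun j => c j • a, fun j => M.smul_mem _ ha, ?_⟩
    simp [Finset.mul_sum]
  | add x _ y _ hx hy =>
    obtain ⟨c, hc, rfl⟩ := hx
    obtain ⟨c', hc', rfl⟩ := hy
    exact ⟨c + c', fun j => add_mem (hc j) (hc' j), by simp [add_mul, Finset.sum_add_distrib]⟩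

/-- If a linear functional kills `x ^ s R ^ m` for `m > 0`, it cannot distinguish the determinant
of `x - ρ` from that of `x`, for a matrix `ρ` with entries in `R`. -/
theorem apply_det_smul_one_sub {S κ : Type*} [CommRing S] [Algebra ℂ S] [Fintype κ] [DecidableEq κ]
    (L : S →ₗ[ℂ] ℂ) (x : S) (R : Submodule ℂ S)
    (hL : ∀ s m, 0 < m → ∀ z ∈ R ^ m, L (x ^ s * z) = 0)
    (ρ : Matrix κ κ S) (hρ : ∀ i j, ρ i j ∈ R) :
    L (x • (1 : Matrix κ κ S) - ρ).det = L (x ^ Fintype.card κ) := by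
  -- In the expansion of the product, every term with a factor `z i` is killed by `L`.
  have hprod : ∀ (c : κ → ℂ) (z : κ → S), (∀ i, z i ∈ R) →
      L (∏ i, (c i • x + z i)) = L (∏ i, c i • x) := by
    intro c z hz
    rw [Finset.prod_add, map_sum, Finset.sum_eq_single Finset.univ]
    · simp
    · intro s _ hs
      rw [Finset.prod_smul, Finset.prod_const, smul_mul_assoc, map_smul,
        hL _ (Finset.univ \ s).card, smul_zero]
      · rw [Finset.card_pos, Finset.sdiff_nonempty]
        exact fun h => hs (Finset.eq_univ_iff_forall.2 fun i => h (Finset.mem_univ i))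
      · exact prod_mem_pow_card R _ z fun i _ => hz i
    · simp
  have hone : x ^ Fintype.card κ = (x • (1 : Matrix κ κ S)).det := by simp
  rw [hone, Matrix.det_apply, Matrix.det_apply, map_sum, map_sum]
  refine Finset.sum_congr rfl fun σ _ => ?_
  have hentry : ∀ i, (x • (1 : Matrix κ κ S)) (σ i) i = (if σ i = i then (1 : ℂ) else 0) • x := by
    intro i
    by_cases h : σ i = i <;> simp [h]
  simp only [Matrix.sub_apply, hentry, sub_eq_add_neg, Units.smul_def, map_zsmul]
  rw [hprod _ (fun i => -ρ (σ i) i) fun i => neg_mem (hρ _ _)]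

/-- Two spaces of forms of degree `r`, each without common zeros other than the origin, have powers
which are not orthogonal for the apolar pairing. -/
theorem exists_apolar_mul_ne_zero [Nonempty ι]
    {A B : Submodule ℂ (MvPolynomial ι ℂ)} (hA : A ≤ homogeneousSubmodule ι ℂ r)
    (hB : B ≤ homogeneousSubmodule ι ℂ r)
    (hA0 : ∀ g : ι → ℂ, (∀ p ∈ A, eval g p = 0) → g = 0)
    (hB0 : ∀ g : ι → ℂ, (∀ p ∈ B, eval g p = 0) → g = 0) :
    ∃ m, 0 < m ∧ ∃ F ∈ A ^ m, ∃ G ∈ B ^ m,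
      apolar ι ℂ (rename Sum.inl F * rename Sum.inr G) ≠ 0 := by
  by_contra! hv
  obtain ⟨n₁, hn₁⟩ := exists_forall_homogeneousSubmodule_le_mul hA hA0
  obtain ⟨n₂, hn₂⟩ := exists_forall_homogeneousSubmodule_le_mul hB hB0
  let n := max n₁ n₂
  let l : MvPolynomial ι ℂ →ₐ[ℂ] MvPolynomial (ι ⊕ ι) ℂ := rename Sum.inl
  let l' : MvPolynomial ι ℂ →ₐ[ℂ] MvPolynomial (ι ⊕ ι) ℂ := rename Sum.inr
  let H : ℕ → Submodule ℂ (MvPolynomial ι ℂ) := homogeneousSubmodule ι ℂ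
  let E := (H n).map l.toLinearMap * (H n).map l'.toLinearMap
  let R := A.map l.toLinearMap * B.map l'.toLinearMap
  let t := pairingForm ι ℂ
  have hmap : ∀ (f : MvPolynomial ι ℂ →ₐ[ℂ] MvPolynomial (ι ⊕ ι) ℂ)
      (M : Submodule ℂ (MvPolynomial ι ℂ)), H (n + r) ≤ M * H n →
      (H r).map f.toLinearMap * (H n).map f.toLinearMap ≤
        M.map f.toLinearMap * (H n).map f.toLinearMap := by
    intro f M h
    rw [← Submodule.map_mul, ← Submodule.map_mul]
    refine Submodule.map_mono (le_trans ?_ h)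
    rw [add_comm]
    exact homogeneousSubmodule_mul r n
  -- `t ^ r E` consists of forms of bidegree `(n + r, n + r)`, all of which lie in `R E`.
  have hE : ∀ e ∈ E, t ^ r * e ∈ R * E := by
    intro e he
    have h := Submodule.mul_mem_mul (pairingForm_pow_mem (ι := ι) r) he
    rw [mul_mul_mul_comm] at h
    have h' := mul_le_mul' (hmap l A (hn₁ n (le_max_left _ _)))
      (hmap l' B (hn₂ n (le_max_right _ _))) h
    rwa [mul_mul_mul_comm] at h'
  -- The hypothesis `hv` says that `L` vanishes on `R ^ m`;
  -- multiplication by `t` only scales `L` there.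
  have hL : ∀ s m, 0 < m → ∀ z ∈ R ^ m, apolar ι ℂ ((t ^ r) ^ s * z) = 0 := by
    intro s m hm z hz
    rw [mul_pow, ← Submodule.map_pow, ← Submodule.map_pow] at hz
    induction hz using Submodule.mul_induction_on' with
    | mem_mul_mem a ha b hb =>
      obtain ⟨F, hF, rfl⟩ := ha
      obtain ⟨G, hG, rfl⟩ := hb
      have hF' : IsWeightedHomogeneous (Sum.elim 0 1 : ι ⊕ ι → ℕ) (l F) _ :=
        map_rename_homogeneousSubmodule_le Sum.inl _ 0 (fun _ => rfl) (r * m)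
          (Submodule.mem_map_of_mem (pow_le_homogeneousSubmodule hA m hF))
      have hG' : IsWeightedHomogeneous (Sum.elim 0 1 : ι ⊕ ι → ℕ) (l' G) _ :=
        map_rename_homogeneousSubmodule_le Sum.inr _ 1 (fun _ => rfl) (r * m)
          (Submodule.mem_map_of_mem (pow_le_homogeneousSubmodule hB m hG))
      have h := apolar_pairingForm_pow_mul (hF'.mul hG') (r * s)
      rw [hv m hm F hF G hG, mul_zero, pow_mul] at h
      exact h
    | add x _ y _ hx hy => rw [mul_add, map_add, hx, hy, add_zero]
  obtain ⟨N, e, he⟩ := Submodule.fg_iff_exists_fin_generating_family.1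
    (((homogeneousSubmodule_fg (σ := ι) (R := ℂ) n).map l.toLinearMap).mul
      ((homogeneousSubmodule_fg (σ := ι) (R := ℂ) n).map l'.toLinearMap))
  have hρ : ∀ i, ∃ c : Fin N → MvPolynomial (ι ⊕ ι) ℂ, (∀ j, c j ∈ R) ∧
      t ^ r * e i = ∑ j, c j * e j := by
    intro i
    refine exists_sum_mul_of_mem_mul_span R e ?_
    rw [he]
    exact hE _ (he.le (Submodule.subset_span ⟨i, rfl⟩))
  choose ρ hρR hρe using hρ
  have he0 : e ≠ 0 := by
    rintro rfl
    have h := pairingForm_pow_mem (ι := ι) n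
    rw [← he] at h
    have h0 : pairingForm ι ℂ ^ n = 0 :=
      (Submodule.span_le (p := ⊥)).2 (by rintro _ ⟨i, rfl⟩; rfl) h
    exact apolar_pairingForm_pow_ne_zero (ι := ι) (K := ℂ) n (by rw [h0, map_zero])
  have hdet : (t ^ r • (1 : Matrix (Fin N) (Fin N) _) - Matrix.of ρ).det = 0 := by
    refine Matrix.exists_mulVec_eq_zero_iff.1 ⟨e, he0, ?_⟩
    ext1 i
    rw [Matrix.sub_mulVec, Matrix.smul_mulVec, Matrix.one_mulVec]
    simp [Matrix.mulVec, dotProduct, hρe]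
  have h := apply_det_smul_one_sub (apolar ι ℂ) (t ^ r) R hL (Matrix.of ρ) hρR
  rw [hdet, map_zero, ← pow_mul] at h
  exact apolar_pairingForm_pow_ne_zero _ h.symm

end Integrality

open scoped Pointwise in
/-- The non-orthogonal elements provided by `exists_apolar_mul_ne_zero` can be taken to be products
of elements of given spanning sets. -/
theorem exists_apolar_prod_ne_zero {ι : Type*} [Fintype ι] [Nonempty ι] {r : ℕ}
    {S T : Set (MvPolynomial ι ℂ)} (hS : ∀ p ∈ S, p.IsHomogeneous r)
    (hT : ∀ p ∈ T, p.IsHomogeneous r)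
    (hS0 : ∀ g : ι → ℂ, (∀ p ∈ S, eval g p = 0) → g = 0)
    (hT0 : ∀ g : ι → ℂ, (∀ p ∈ T, eval g p = 0) → g = 0) :
    ∃ m, 0 < m ∧ ∃ (p : Fin m → S) (q : Fin m → T),
      apolar ι ℂ ((∏ i, rename Sum.inl (p i).1) * ∏ j, rename Sum.inr (q j).1) ≠ 0 := by
  obtain ⟨m, hm, F, hF, G, hG, hFG⟩ := exists_apolar_mul_ne_zero
    (A := Submodule.span ℂ S) (B := Submodule.span ℂ T)
    (Submodule.span_le.2 hS) (Submodule.span_le.2 hT)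
    (fun g hg => hS0 g fun p hp => hg p (Submodule.subset_span hp))
    (fun g hg => hT0 g fun p hp => hg p (Submodule.subset_span hp))
  refine ⟨m, hm, ?_⟩
  by_contra! hv
  apply hFG
  let β : MvPolynomial ι ℂ →ₗ[ℂ] MvPolynomial ι ℂ →ₗ[ℂ] ℂ :=
    ((LinearMap.mul ℂ _).compr₂ (apolar ι ℂ)).compl₁₂ (rename Sum.inl).toLinearMap
      (rename Sum.inr).toLinearMap
  rw [Submodule.span_pow] at hF hG
  have h : ∀ F ∈ S ^ m, ∀ G ∈ T ^ m, β F G = 0 := by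
    intro F hF G hG
    obtain ⟨p, rfl⟩ := Set.mem_pow.1 hF
    obtain ⟨q, rfl⟩ := Set.mem_pow.1 hG
    simpa [β, List.prod_ofFn] using hv p q
  have h' : ∀ F ∈ S ^ m, β F G = 0 := fun F hF =>
    (Submodule.span_le (p := LinearMap.ker (β F))).2 (fun G hG => h F hF G hG) hG
  exact (Submodule.span_le (p := LinearMap.ker (β.flip G))).2 h' hF

/-! ### Uniformity -/

/-- Noetherianity: polynomial conditions indexed by `ℕ` are, all together, equivalent to finitely
many stages of them. -/
theorem exists_forall_eval_ne_zero_le {σ : Type*} [Finite σ] (S : ℕ → Set (MvPolynomial σ ℂ)) :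
    ∃ N, ∀ z : σ → ℂ, (∃ m, ∃ f ∈ S m, eval z f ≠ 0) → ∃ m ≤ N, ∃ f ∈ S m, eval z f ≠ 0 := by
  let I : ℕ →o Ideal (MvPolynomial σ ℂ) :=
    ⟨fun N => Ideal.span (⋃ m ≤ N, S m), fun a b hab => Ideal.span_mono
      (Set.biUnion_mono (fun m (hm : m ≤ a) => hm.trans hab) fun _ _ => le_rfl)⟩
  obtain ⟨N, hN⟩ := monotone_stabilizes_iff_noetherian.2
    (inferInstance : IsNoetherian (MvPolynomial σ ℂ) (MvPolynomial σ ℂ)) I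
  refine ⟨N, fun z => ?_⟩
  rintro ⟨m, f, hf, hfz⟩
  by_contra! h
  apply hfz
  have hker : I N ≤ RingHom.ker (eval z) := by
    refine Ideal.span_le.2 fun g hg => ?_
    simp only [Set.mem_iUnion] at hg
    obtain ⟨m', hm', hg⟩ := hg
    exact h m' hm' g hg
  have hmem : f ∈ I (max N m) :=
    Ideal.subset_span (Set.mem_biUnion (show m ≤ max N m from le_max_right _ _) hf)
  rw [← hN _ (le_max_left N m)] at hmem
  exact hker hmem

/-- The form `∑ X_{k b} x ^ b`, summed over the exponents `b ∈ D`, with variables `X_{k b}` as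
coefficients. -/
def genericForm {ι σ : Type*} (D : Finset (ι →₀ ℕ)) (k : D → σ) :
    MvPolynomial ι (MvPolynomial σ ℂ) := ∑ b : D, monomial b.1 (X (k b))

theorem map_eval_genericForm {ι σ : Type*} {D : Finset (ι →₀ ℕ)} {k : D → σ} {z : σ → ℂ}
    {P : MvPolynomial ι ℂ} (hP : P.support ⊆ D) (hz : ∀ b, z (k b) = coeff b.1 P) :
    map (eval z) (genericForm D k) = P := by
  simp only [genericForm, map_sum, map_monomial, eval_X, hz]
  rw [Finset.sum_coe_sort D fun b => monomial b (coeff b P)]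
  conv_rhs => rw [P.as_sum]
  refine (Finset.sum_subset hP fun b _ hb => ?_).symm
  rw [notMem_support_iff.1 hb, monomial_zero]

/-- A space of polynomials with exponents in `D` is spanned by a family indexed by `D`, the image
of the monomials under a projection. -/
theorem exists_span_range_eq {ι : Type*} {D : Finset (ι →₀ ℕ)}
    {A : Submodule ℂ (MvPolynomial ι ℂ)} (hA : ∀ F ∈ A, F.support ⊆ D) :
    ∃ p : D → MvPolynomial ι ℂ, Submodule.span ℂ (Set.range p) = A := by
  obtain ⟨π, hπ⟩ := A.subtype.exists_leftInverse_of_injective A.ker_subtype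
  refine ⟨fun a => π (monomial a.1 1), le_antisymm ?_ fun F hF => ?_⟩
  · rw [Submodule.span_le]
    rintro _ ⟨a, rfl⟩
    exact (π _).2
  · have h : (π F : MvPolynomial ι ℂ) = F :=
      congrArg Subtype.val (LinearMap.congr_fun hπ ⟨F, hF⟩)
    rw [← h, F.as_sum, map_sum, Submodule.coe_sum]
    refine sum_mem fun s hs => ?_
    have hmon : monomial s (coeff s F) = coeff s F • (monomial s 1 : MvPolynomial ι ℂ) := by
      simp [smul_monomial]
    rw [hmon, map_smul]
    exact Submodule.smul_mem _ _ (Submodule.subset_span ⟨⟨s, hA F hF hs⟩, rfl⟩)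

/-- The apolar pairing of products of `m` generic forms: `D × D` parametrizes the coefficients of a
family of forms indexed by `D`, on either side. -/
def genericPairing {ι : Type*} [Fintype ι] (D : Finset (ι →₀ ℕ)) {m : ℕ} (a b : Fin m → D) :
    MvPolynomial ((D × D) ⊕ (D × D)) ℂ :=
  apolar ι _ ((∏ i, rename Sum.inl (genericForm D fun c => .inl (a i, c))) *
    ∏ j, rename Sum.inr (genericForm D fun c => .inr (b j, c)))

theorem eval_genericPairing {ι : Type*} [Fintype ι] {D : Finset (ι →₀ ℕ)}
    {p q : D → MvPolynomial ι ℂ} (hp : ∀ a, (p a).support ⊆ D) (hq : ∀ a, (q a).support ⊆ D)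
    {m : ℕ} (a b : Fin m → D) :
    eval (Sum.elim (fun c => coeff c.2.1 (p c.1)) fun c => coeff c.2.1 (q c.1))
      (genericPairing D a b) =
      apolar ι ℂ ((∏ i, rename Sum.inl (p (a i))) * ∏ j, rename Sum.inr (q (b j))) := by
  set z : (D × D) ⊕ (D × D) → ℂ :=
    Sum.elim (fun c => coeff c.2.1 (p c.1)) fun c => coeff c.2.1 (q c.1)
  have hzp : ∀ a, map (eval z) (genericForm D fun c => .inl (a, c)) = p a := fun a =>
    map_eval_genericForm (hp a) fun _ => rfl
  have hzq : ∀ b, map (eval z) (genericForm D fun c => .inr (b, c)) = q b := fun b =>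
    map_eval_genericForm (hq b) fun _ => rfl
  simp only [genericPairing, ← apolar_map, map_mul, map_prod, map_rename, hzp, hzq]

/-- The number of factors needed to make two spaces of forms without common zeros
non-orthogonal is bounded in terms of the number of variables and the degree. -/
theorem exists_bound_apolar_prod_ne_zero (ι : Type*) [Fintype ι] [Nonempty ι] (r : ℕ) :
    ∃ N, ∀ A B : Submodule ℂ (MvPolynomial ι ℂ),
      A ≤ homogeneousSubmodule ι ℂ r → B ≤ homogeneousSubmodule ι ℂ r →
      (∀ g : ι → ℂ, (∀ p ∈ A, eval g p = 0) → g = 0) →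
      (∀ g : ι → ℂ, (∀ p ∈ B, eval g p = 0) → g = 0) →
      ∃ m, 0 < m ∧ m ≤ N ∧ ∃ p q : Fin m → MvPolynomial ι ℂ,
        (∀ i, p i ∈ A) ∧ (∀ i, q i ∈ B) ∧
        apolar ι ℂ ((∏ i, rename Sum.inl (p i)) * ∏ j, rename Sum.inr (q j)) ≠ 0 := by
  classical
  let D : Finset (ι →₀ ℕ) := Finset.univ.finsuppAntidiag r
  have hD : ∀ F : MvPolynomial ι ℂ, F.IsHomogeneous r → F.support ⊆ D := by
    intro F hF s hs
    have h : s.degree = r := by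
      by_contra h
      exact (mem_support_iff.1 hs) (hF.coeff_eq_zero h)
    simpa [D, Finset.mem_finsuppAntidiag, Finsupp.degree_eq_sum] using h
  clear_value D
  obtain ⟨N, hN⟩ := exists_forall_eval_ne_zero_le fun m =>
    {F | 0 < m ∧ ∃ a b : Fin m → D, F = genericPairing D a b}
  refine ⟨N, fun A B hA hB hA0 hB0 => ?_⟩
  obtain ⟨p, rfl⟩ := exists_span_range_eq fun F hF => hD F (hA hF)
  obtain ⟨q, rfl⟩ := exists_span_range_eq fun F hF => hD F (hB hF)
  have hp : ∀ a, (p a).IsHomogeneous r := fun a => hA (Submodule.subset_span ⟨a, rfl⟩)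
  have hq : ∀ a, (q a).IsHomogeneous r := fun a => hB (Submodule.subset_span ⟨a, rfl⟩)
  have hzero : ∀ (P : D → MvPolynomial ι ℂ) (g : ι → ℂ),
      (∀ F ∈ Set.range P, eval g F = 0) → ∀ F ∈ Submodule.span ℂ (Set.range P), eval g F = 0 := by
    intro P g h F hF
    exact (Submodule.span_le (p := LinearMap.ker (aeval g).toLinearMap)).2
      (fun F hF => by simpa [coe_aeval_eq_eval] using h F hF) hF
  obtain ⟨m, hm, P, Q, hPQ⟩ := exists_apolar_prod_ne_zero (S := Set.range p) (T := Set.range q)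
    (by rintro _ ⟨a, rfl⟩; exact hp a) (by rintro _ ⟨a, rfl⟩; exact hq a)
    (fun g hg => hA0 g (hzero p g hg)) (fun g hg => hB0 g (hzero q g hg))
  choose a ha using fun i => (P i).2
  choose b hb using fun i => (Q i).2
  simp only [← ha, ← hb] at hPQ
  have heval := @eval_genericPairing ι _ D p q (fun a => hD _ (hp a)) fun a => hD _ (hq a)
  obtain ⟨m', hm', F, ⟨h0, a', b', rfl⟩, hF⟩ := hN
    (Sum.elim (fun c => coeff c.2.1 (p c.1)) fun c => coeff c.2.1 (q c.1))
    ⟨m, genericPairing D a b, ⟨hm, a, b, rfl⟩, by rwa [heval]⟩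
  rw [heval] at hF
  exact ⟨m', h0, hm', fun i => p (a' i), fun j => q (b' j),
    fun i => Submodule.subset_span ⟨a' i, rfl⟩, fun j => Submodule.subset_span ⟨b' j, rfl⟩, hF⟩

/-! ### Rank decomposition -/

/-- A bilinear form of rank `n` is a sum of `n` products of linear forms, independent on either
side. -/
theorem exists_rank_decomposition {V : Type u} {W : Type v} [AddCommGroup V] [Module ℂ V]
    [FiniteDimensional ℂ V] [AddCommGroup W] [Module ℂ W] (u : Module.Dual ℂ (V ⊗[ℂ] W)) :
    ∃ n ≤ Module.finrank ℂ V, ∃ (φ : Fin n → Module.Dual ℂ V) (ψ : Fin n → Module.Dual ℂ W),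
      LinearIndependent ℂ φ ∧ LinearIndependent ℂ ψ ∧
      ∀ v w, u (v ⊗ₜ w) = ∑ i, φ i v * ψ i w := by
  let U := TensorProduct.curry u
  let b := Module.finBasis ℂ (LinearMap.range U)
  refine ⟨_, LinearMap.finrank_range_le U, fun i => b.coord i ∘ₗ U.rangeRestrict,
    fun i => (b i : Module.Dual ℂ W), ?_, ?_, fun v w => ?_⟩
  · have h := b.dualBasis.linearIndependent.map' (U.rangeRestrict.dualMap)
      (LinearMap.ker_eq_bot.2 (LinearMap.dualMap_injective_of_surjective
        U.surjective_rangeRestrict))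
    have he : (U.rangeRestrict.dualMap ∘ b.dualBasis) = fun i => b.coord i ∘ₗ U.rangeRestrict := by
      ext i v
      simp
    rwa [he] at h
  · exact b.linearIndependent.map' (LinearMap.range U).subtype (Submodule.ker_subtype _)
  · have h : (U v : Module.Dual ℂ W) = ∑ i, b.coord i (U.rangeRestrict v) • (b i).1 := by
      have := congrArg (LinearMap.range U).subtype (b.sum_repr (U.rangeRestrict v))
      rw [map_sum] at this
      exact this.symm
    have h' := LinearMap.congr_fun h w
    simpa [U] using h'

/-- Restricting to the span of independent linear forms creates no new common zeros. -/
theorem eq_zero_of_forall_eval_symPoly {V : Type u} [AddCommGroup V] [Module ℂ V] {ι : Type*}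
    [Fintype ι] {r : ℕ} {A : Submodule ℂ (Sym[ℂ]^r V)} (hA : SymPow.commonZeros A ⊆ {0})
    {φ : ι → Module.Dual ℂ V} (hφ : LinearIndependent ℂ φ) (g : ι → ℂ)
    (hg : ∀ p ∈ A.map (symPoly φ), eval g p = 0) : g = 0 := by
  have h : ∑ i, g i • φ i = 0 := hA fun a ha => by
    rw [← eval_symPoly]
    exact hg _ (Submodule.mem_map_of_mem ha)
  exact funext (Fintype.linearIndependent_iff.1 hφ g h)

end

/-! ### The bound -/

theorem mainTheorem3 :
    ∃ ν : ℕ → ℕ → ℕ,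
      ∀ (r d : ℕ)
        (V : Type u) [AddCommGroup V] [Module ℂ V] [FiniteDimensional ℂ V]
        (W : Type v) [AddCommGroup W] [Module ℂ W] [FiniteDimensional ℂ W],
        Module.finrank ℂ V = d →
        ∀ (A : Submodule ℂ (Sym[ℂ]^r V)) (B : Submodule ℂ (Sym[ℂ]^r W)),
          SymPow.commonZeros A ⊆ {0} →
          SymPow.commonZeros B ⊆ {0} →
          ∀ u : Module.Dual ℂ (V ⊗[ℂ] W), u ≠ 0 →
            ∃ m : ℕ, 0 < m ∧ m ≤ ν r d ∧
              ∃ (x : Fin m → Sym[ℂ]^r V) (y : Fin m → Sym[ℂ]^r W),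
                (∀ i, x i ∈ A) ∧ (∀ i, y i ∈ B) ∧
                ∃ γ : BiregularGraph m r, γ.value u x y ≠ 0 := by
  choose N hN using fun n r => exists_bound_apolar_prod_ne_zero (Fin (n + 1)) r
  -- The rank of `u` is between `1` and `d`.
  refine ⟨fun r d => (Finset.range d).sup fun n => N n r, ?_⟩
  intro r d V _ _ _ W _ _ _ hd A B hA hB u hu
  obtain ⟨n, hn, φ, ψ, hφ, hψ, huφψ⟩ := exists_rank_decomposition u
  have hn0 : n ≠ 0 := by
    rintro rfl
    apply hu
    ext v w
    simp [huφψ]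
  obtain ⟨n, rfl⟩ := Nat.exists_eq_succ_of_ne_zero hn0
  obtain ⟨m, hm, hmN, p, q, hp, hq, hpq⟩ := hN n r (A.map (symPoly φ)) (B.map (symPoly ψ))
    (Submodule.map_le_iff_le_comap.2 fun x _ => symPoly_isHomogeneous φ x)
    (Submodule.map_le_iff_le_comap.2 fun x _ => symPoly_isHomogeneous ψ x)
    (eq_zero_of_forall_eval_symPoly hA hφ) (eq_zero_of_forall_eval_symPoly hB hψ)
  choose x hxA hx using hp
  choose y hyB hy using hq
  refine ⟨m, hm, hmN.trans (Finset.le_sup (f := fun n => N n r) (Finset.mem_range.2 (by omega))),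
    x, y, hxA, hyB, ?_⟩
  simp only [← hx, ← hy] at hpq
  rw [← sum_value_permGraph u φ ψ huφψ] at hpq
  obtain ⟨σ, _, hσ⟩ := Finset.exists_ne_zero_of_sum_ne_zero hpq
  exact ⟨permGraph σ, hσ⟩
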